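/- Let $n\ge 1$, let $g_1,\dots,g_n\in\mathbb{C}[z]$ be polynomials, and let $f:\mathbb{C}\to X:=\{[1:\zeta_1:\cdots:\zeta_n]\in\mathbb{C}P^n \mid \zeta_i\neq 0 \text{ for all } i\}$ be the holomorphic map \[ f(z)=[1:e^{g_1(z)}:\cdots:e^{g_n(z)}]. \] Equip $X$ with the restriction of the Fubini–Study metric of $\mathbb{C}P^n$, normalized so that in the affine coordinates $\zeta$ its Hermitian matrix is $\frac1\pi\,\frac{\partial^2}{\partial\zeta_i\,\partial\bar\zeta_j}\log\bigl(1+\sum_k|\zeta_k|^2\bigr)$, and put $|df|(z):=\sqrt2\,|df(\partial/\partial z)|$, where $\partial/\partial z=\frac12(\partial/\partial x-\sqrt{-1}\,\partial/\partial y)$; equivalently, \[ |df|^2(z)=\frac1{4\pi}\,\Delta\log\Bigl(1+\sum_{i=1}^n|e^{g_i(z)}|^2\Bigr),\qquad \Delta=\frac{\partial^2}{\partial x^2}+\frac{\partial^2}{\partial y^2}. \] Define the integer $m\ge -1$ by $m+1=\max(\deg g_1,\dots,\deg g_n)$, where constant polynomials, including $0$, have degree $0$. If $m\ge 0$ (that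 is, if $f$ is not constant), then \[ \limsup_{r\to\infty}\frac{\max_{|z|=r}\log|df|(z)}{\log r}=m, \] where $\log 0=-\infty$ and, for each $r>0$, the maximum over the circle $|z|=r$ is attained. -/

import Mathlib

open scoped LinearAlgebra.Projectivization

noncomputable section

namespace TorusCurve

/-- The vector `(1, ζ₁, …, ζₙ)` of homogeneous coordinates. -/
def homog {n : ℕ} (ζ : Fin n → ℂ) : Fin (n + 1) → ℂ := Fin.cons 1 ζ

theorem homog_ne_zero {n : ℕ} (ζ : Fin n → ℂ) : homog ζ ≠ 0 := by
  intro h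
  have h0 := congrFun h 0
  simp [homog] at h0

/-- The point `[1 : ζ₁ : ⋯ : ζₙ]` of `ℂPⁿ`. -/
def point {n : ℕ} (ζ : Fin n → ℂ) : ℙ ℂ (Fin (n + 1) → ℂ) :=
  Projectivization.mk ℂ (homog ζ) (homog_ne_zero ζ)

/-- `X = {[1 : ζ₁ : ⋯ : ζₙ] | ζᵢ ≠ 0 for all i} ⊆ ℂPⁿ`. -/
def X (n : ℕ) : Set (ℙ ℂ (Fin (n + 1) → ℂ)) :=
  {p | ∃ ζ : Fin n → ℂ, (∀ i, ζ i ≠ 0) ∧ p = point ζ}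

/-- The affine coordinates `[w₀ : ⋯ : wₙ] ↦ (w₁ / w₀, …, wₙ / w₀)`, a holomorphic chart on
`{w₀ ≠ 0}`, which contains `X n`. -/
def affineCoord {n : ℕ} : ℙ ℂ (Fin (n + 1) → ℂ) → (Fin n → ℂ) :=
  Projectivization.lift (fun w i => w.1 i.succ / w.1 0) (by
    rintro ⟨a, ha⟩ ⟨b, hb⟩ t h
    simp only at h
    have ht : t ≠ 0 := by
      rintro rfl
      exact ha (by simp [h])
    funext i
    simp only [h, Pi.smul_apply, smul_eq_mul]
    exact mul_div_mul_left _ _ ht)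

theorem affineCoord_point {n : ℕ} (ζ : Fin n → ℂ) : affineCoord (point ζ) = ζ := by
  funext i
  simp [affineCoord, point, homog]

/-- The Fubini–Study metric of `ℂPⁿ` in the affine coordinates, as a Riemannian metric: the inner
product, at the point with coordinates `ζ`, of the tangent vectors with coordinates `v` and `w`.
It is the real part of the Hermitian form with matrix
`(1 / π) ∂²/∂ζᵢ∂ζ̄ⱼ log (1 + ∑ |ζₖ|²)`. -/
def fubiniStudy {n : ℕ} (ζ v w : Fin n → ℂ) : ℝ :=
  (1 / Real.pi) *
    ((1 + ∑ i, ‖ζ i‖ ^ 2) * (∑ i, v i * star (w i)).re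
      - ((∑ i, v i * star (ζ i)) * (∑ i, ζ i * star (w i))).re)
    / (1 + ∑ i, ‖ζ i‖ ^ 2) ^ 2

/-- The norm of the complexified tangent vector `a + √-1 b` (with `a`, `b` real tangent vectors at
`ζ`) for the Hermitian extension of the Fubini–Study metric. -/
def complexifiedNorm {n : ℕ} (ζ a b : Fin n → ℂ) : ℝ :=
  √(fubiniStudy ζ a a + fubiniStudy ζ b b)

/-- `|df|(z) = √2 |df(∂/∂z)|`, with `∂/∂z = (1/2) (∂/∂x - √-1 ∂/∂y)`. -/
def normDf {n : ℕ} (f : ℂ → X n) (z : ℂ) : ℝ :=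
  let F : ℂ → (Fin n → ℂ) := fun u => affineCoord (f u).1
  √2 * complexifiedNorm (F z)
    ((1 / 2 : ℝ) • fderiv ℝ F z 1) (-(1 / 2 : ℝ) • fderiv ℝ F z Complex.I)

/-- The map `z ↦ [1 : exp (g₁ z) : ⋯ : exp (gₙ z)]`. -/
def expCurve {n : ℕ} (g : Fin n → Polynomial ℂ) (z : ℂ) : X n :=
  ⟨point fun i => Complex.exp ((g i).eval z),
    fun i => Complex.exp ((g i).eval z), fun _ => Complex.exp_ne_zero _, rfl⟩

/-- `log |df|(z)`, with the value `-∞` where `|df|(z) = 0`. -/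
def logNormDf {n : ℕ} (f : ℂ → X n) (z : ℂ) : EReal :=
  ENNReal.log (ENNReal.ofReal (normDf f z))

/-- `max_{|z| = r} log |df|(z)`. -/
def maxLogNormDf {n : ℕ} (f : ℂ → X n) (r : ℝ) : EReal :=
  ⨆ z ∈ Metric.sphere (0 : ℂ) r, logNormDf f z

end TorusCurve

end

open Polynomial Filter Topology Bornology

namespace TorusCurve

/-! ### Weighted variance -/

/-! Put g₀ = 0. Up to the factor 1/π, |df|² is the variance of the derivatives gᵢ' under the
probability weights proportional to |exp gᵢ|². A variance is at most the largest |gᵢ'|², so |df| =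
O(r^m): this is `eventually_normDf_expCurve_le`.

For the lower bound, write the variance as a sum over pairs of |gᵢ' - gⱼ'|². If two coordinates of
maximal modulus have different coefficients of degree m + 1, both have weight at least 1/(n + 1),
and |df| is at least a constant times |gᵢ' - gⱼ'|, which has order r^m (`le_normDf_expCurve`). By
connectedness every large circle contains such a point (`eventually_exists_two_maximal`). The
quotient therefore converges to m, which is more than the limsup asks. -/

theorem sum_sum_mul_sub_sq {ι : Type*} [Fintype ι] (p x : ι → ℝ) :
    ∑ i, ∑ j, p i * p j * (x i - x j) ^ 2 =
      2 * ((∑ i, p i) * ∑ i, p i * x i ^ 2 - (∑ i, p i * x i) ^ 2) := by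
  have h : ∀ i j, p i * p j * (x i - x j) ^ 2 =
      (p i * x i ^ 2) * p j + p i * (p j * x j ^ 2) - 2 * ((p i * x i) * (p j * x j)) := by
    intro i j; ring
  simp only [h, Finset.sum_add_distrib, Finset.sum_sub_distrib, ← Finset.mul_sum,
    ← Finset.sum_mul]
  ring

/-- The right side is the form in which the Fubini–Study norm appears; the left side is a sum of
nonnegative terms, hence bounded below by any one of them. -/
theorem sum_sum_mul_norm_sub_sq {ι : Type*} [Fintype ι] (p : ι → ℝ) (D : ι → ℂ) :
    ∑ i, ∑ j, p i * p j * ‖D i - D j‖ ^ 2 =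
      2 * ((∑ i, p i) * ∑ i, p i * ‖D i‖ ^ 2 - ‖∑ i, (p i : ℂ) * D i‖ ^ 2) := by
  have hn : ∀ w : ℂ, ‖w‖ ^ 2 = w.re ^ 2 + w.im ^ 2 := by
    intro w; rw [← Complex.normSq_eq_norm_sq, Complex.normSq_apply]; ring
  have h1 := sum_sum_mul_sub_sq p fun i => (D i).re
  have h2 := sum_sum_mul_sub_sq p fun i => (D i).im
  simp only [hn, Complex.sub_re, Complex.sub_im, Complex.re_sum, Complex.im_sum,
    Complex.re_ofReal_mul, Complex.im_ofReal_mul, mul_add, Finset.sum_add_distrib] at *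
  rw [h1, h2]; ring

/-! ### The norm of the differential of an exponential curve -/

/-- The family `0, g₁, …, gₙ` of exponents of the homogeneous coordinates. -/
noncomputable def exponents {n : ℕ} (g : Fin n → ℂ[X]) : Fin (n + 1) → ℂ[X] := Fin.cons 0 g

/-- The squared modulus of a homogeneous coordinate. -/
noncomputable def weight {n : ℕ} (g : Fin n → ℂ[X]) (z : ℂ) (i : Fin (n + 1)) : ℝ :=
  ‖Complex.exp ((exponents g i).eval z)‖ ^ 2

/-- The logarithmic derivative of a homogeneous coordinate. -/
noncomputable def logDer {n : ℕ} (g : Fin n → ℂ[X]) (z : ℂ) (i : Fin (n + 1)) : ℂ :=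
  (derivative (exponents g i)).eval z

theorem weight_pos {n : ℕ} (g : Fin n → ℂ[X]) (z : ℂ) (i : Fin (n + 1)) : 0 < weight g z i := by
  have := Complex.exp_ne_zero ((exponents g i).eval z)
  unfold weight; positivity

theorem sum_weight_pos {n : ℕ} (g : Fin n → ℂ[X]) (z : ℂ) : 0 < ∑ i, weight g z i :=
  Finset.sum_pos (fun i _ => weight_pos g z i) Finset.univ_nonempty

theorem fubiniStudy_smul_self {n : ℕ} (c : ℂ) (ζ v : Fin n → ℂ) :
    fubiniStudy ζ (c • v) (c • v) = ‖c‖ ^ 2 * fubiniStudy ζ v v := by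
  have hc : c * star c = ((‖c‖ ^ 2 : ℝ) : ℂ) := by
    rw [Complex.star_def, Complex.mul_conj, Complex.normSq_eq_norm_sq]
  have h1 : ∑ i, (c • v) i * star ((c • v) i) = ((‖c‖ ^ 2 : ℝ) : ℂ) * ∑ i, v i * star (v i) := by
    rw [← hc, Finset.mul_sum]
    refine Finset.sum_congr rfl fun i _ => ?_
    simp only [Pi.smul_apply, smul_eq_mul, star_mul']; ring
  have h2 : (∑ i, (c • v) i * star (ζ i)) * (∑ i, ζ i * star ((c • v) i)) =
      ((‖c‖ ^ 2 : ℝ) : ℂ) * ((∑ i, v i * star (ζ i)) * ∑ i, ζ i * star (v i)) := by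
    have e1 : ∑ i, (c • v) i * star (ζ i) = c * ∑ i, v i * star (ζ i) := by
      rw [Finset.mul_sum]
      refine Finset.sum_congr rfl fun i _ => ?_
      simp only [Pi.smul_apply, smul_eq_mul]; ring
    have e2 : ∑ i, ζ i * star ((c • v) i) = star c * ∑ i, ζ i * star (v i) := by
      rw [Finset.mul_sum]
      refine Finset.sum_congr rfl fun i _ => ?_
      simp only [Pi.smul_apply, smul_eq_mul, star_mul']; ring
    rw [e1, e2, ← hc]; ring
  unfold fubiniStudy
  rw [h1, h2, Complex.re_ofReal_mul, Complex.re_ofReal_mul]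
  ring

/-- By holomorphy the derivatives along `1` and `I` are v and iv, so the two halves of ∂/∂z
contribute a quarter of the squared norm of v each; the factor √2 makes the total exactly one. -/
theorem normDf_eq_sqrt_fubiniStudy {n : ℕ} (f : ℂ → X n) (z : ℂ) (v : Fin n → ℂ)
    (h : HasDerivAt (fun u => affineCoord (f u).1) v z) :
    normDf f z = √(fubiniStudy (affineCoord (f z).1) v v) := by
  have h' := h.hasFDerivAt.restrictScalars ℝ
  have e1 : (1 / 2 : ℝ) • fderiv ℝ (fun u => affineCoord (f u).1) z 1 = (1 / 2 : ℂ) • v := by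
    rw [h'.fderiv]; ext i; simp
  have e2 : -(1 / 2 : ℝ) • fderiv ℝ (fun u => affineCoord (f u).1) z Complex.I =
      (-(1 / 2) * Complex.I : ℂ) • v := by
    rw [h'.fderiv]; ext i; simp; ring
  simp only [normDf, complexifiedNorm]
  rw [e1, e2, fubiniStudy_smul_self, fubiniStudy_smul_self, ← Real.sqrt_mul (by norm_num)]
  congr 1
  simp
  ring

theorem hasDerivAt_affineCoord_expCurve {n : ℕ} (g : Fin n → ℂ[X]) (z : ℂ) :
    HasDerivAt (fun u => affineCoord (expCurve g u).1)
      (fun i => Complex.exp ((g i).eval z) * (derivative (g i)).eval z) z := by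
  simp only [expCurve, affineCoord_point]
  exact hasDerivAt_pi.2 fun i => ((g i).hasDerivAt z).cexp

/-- The index `0`, with weight 1 and logarithmic derivative 0, absorbs the 1 in 1 + ∑|ζᵢ|² and adds
nothing to the other sums. -/
theorem fubiniStudy_exp {n : ℕ} (g : Fin n → ℂ[X]) (z : ℂ) :
    fubiniStudy (fun i => Complex.exp ((g i).eval z))
      (fun i => Complex.exp ((g i).eval z) * (derivative (g i)).eval z)
      (fun i => Complex.exp ((g i).eval z) * (derivative (g i)).eval z) =
    (1 / Real.pi) * ((∑ i, weight g z i) * (∑ i, weight g z i * ‖logDer g z i‖ ^ 2)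
      - ‖∑ i, (weight g z i : ℂ) * logDer g z i‖ ^ 2) / (∑ i, weight g z i) ^ 2 := by
  have hmul : ∀ w : ℂ, w * star w = ((‖w‖ ^ 2 : ℝ) : ℂ) := fun w => by
    rw [Complex.star_def, Complex.mul_conj, Complex.normSq_eq_norm_sq]
  have hS : ∑ i, weight g z i = 1 + ∑ i, ‖Complex.exp ((g i).eval z)‖ ^ 2 := by
    simp [Fin.sum_univ_succ, weight, exponents]
  have hV : ∑ i, weight g z i * ‖logDer g z i‖ ^ 2 =
      (∑ i, (Complex.exp ((g i).eval z) * (derivative (g i)).eval z) *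
        star (Complex.exp ((g i).eval z) * (derivative (g i)).eval z)).re := by
    simp only [hmul, Fin.sum_univ_succ, weight, exponents, logDer, Complex.re_sum,
      Complex.ofReal_re, norm_mul, mul_pow]
    simp
  have hM : ∑ i, (weight g z i : ℂ) * logDer g z i =
      ∑ i, (Complex.exp ((g i).eval z) * (derivative (g i)).eval z) *
        star (Complex.exp ((g i).eval z)) := by
    rw [Fin.sum_univ_succ]
    have h0 : logDer g z 0 = 0 := by simp [logDer, exponents]
    rw [h0, mul_zero, zero_add]
    refine Finset.sum_congr rfl fun i _ => ?_
    rw [mul_right_comm, hmul]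
    simp [weight, exponents, logDer]
  have hM' : ∑ i, Complex.exp ((g i).eval z) *
        star (Complex.exp ((g i).eval z) * (derivative (g i)).eval z) =
      star (∑ i, (weight g z i : ℂ) * logDer g z i) := by
    rw [hM, star_sum]
    refine Finset.sum_congr rfl fun i _ => ?_
    simp only [star_mul', star_star]; ring
  unfold fubiniStudy
  rw [hM', ← hM, ← hV, ← hS, hmul, Complex.ofReal_re]

theorem normDf_expCurve {n : ℕ} (g : Fin n → ℂ[X]) (z : ℂ) :
    normDf (expCurve g) z =
      √((1 / Real.pi) * ((∑ i, weight g z i) * (∑ i, weight g z i * ‖logDer g z i‖ ^ 2)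
        - ‖∑ i, (weight g z i : ℂ) * logDer g z i‖ ^ 2) / (∑ i, weight g z i) ^ 2) := by
  rw [normDf_eq_sqrt_fubiniStudy _ z _ (hasDerivAt_affineCoord_expCurve g z), ← fubiniStudy_exp]
  simp only [expCurve, affineCoord_point]

theorem continuous_normDf_expCurve {n : ℕ} (g : Fin n → ℂ[X]) :
    Continuous (normDf (expCurve g)) := by
  have hw : ∀ i, Continuous fun z => weight g z i := fun i => by
    unfold weight; fun_prop
  have hd : ∀ i, Continuous fun z => logDer g z i := fun i => by
    unfold logDer; fun_prop
  rw [funext (normDf_expCurve g)]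
  refine Real.continuous_sqrt.comp (Continuous.div ?_ ?_ ?_)
  · fun_prop
  · fun_prop
  · exact fun z => (pow_pos (sum_weight_pos g z) 2).ne'

theorem normDf_expCurve_le {n : ℕ} (g : Fin n → ℂ[X]) (z : ℂ) :
    normDf (expCurve g) z ≤ ∑ i, ‖logDer g z i‖ := by
  have hS := sum_weight_pos g z
  rw [normDf_expCurve]
  refine Real.sqrt_le_iff.2 ⟨Finset.sum_nonneg fun i _ => norm_nonneg _, ?_⟩
  rw [div_le_iff₀ (by positivity)]
  have hle : ∀ i, ‖logDer g z i‖ ≤ ∑ i, ‖logDer g z i‖ := fun i =>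
    Finset.single_le_sum (f := fun i => ‖logDer g z i‖) (fun i _ => norm_nonneg _)
      (Finset.mem_univ i)
  have hV : ∑ i, weight g z i * ‖logDer g z i‖ ^ 2 ≤
      (∑ i, weight g z i) * (∑ i, ‖logDer g z i‖) ^ 2 := by
    rw [Finset.sum_mul]
    refine Finset.sum_le_sum fun i _ => mul_le_mul_of_nonneg_left ?_ (weight_pos g z i).le
    exact pow_le_pow_left₀ (norm_nonneg _) (hle i) 2
  have hpi : 1 / Real.pi ≤ 1 := by
    rw [div_le_one Real.pi_pos]; linarith [Real.pi_gt_three]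
  calc _ ≤ (1 / Real.pi) * ((∑ i, weight g z i) * ((∑ i, weight g z i) *
          (∑ i, ‖logDer g z i‖) ^ 2)) := by
        refine mul_le_mul_of_nonneg_left ?_ (by positivity)
        have := mul_le_mul_of_nonneg_left hV hS.le
        nlinarith [sq_nonneg ‖∑ i, (weight g z i : ℂ) * logDer g z i‖]
    _ ≤ 1 * ((∑ i, weight g z i) * ((∑ i, weight g z i) * (∑ i, ‖logDer g z i‖) ^ 2)) :=
        mul_le_mul_of_nonneg_right hpi (by positivity)
    _ = _ := by ring

/-- At a point where two homogeneous coordinates both have maximal modulus, the differential is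
bounded below by the difference of their logarithmic derivatives. -/
theorem le_normDf_expCurve {n : ℕ} (g : Fin n → ℂ[X]) (z : ℂ) (i j : Fin (n + 1))
    (hi : ∀ l, weight g z l ≤ weight g z i) (hj : ∀ l, weight g z l ≤ weight g z j) :
    ‖logDer g z i - logDer g z j‖ / (√(2 * Real.pi) * (n + 1)) ≤ normDf (expCurve g) z := by
  have hS := sum_weight_pos g z
  rw [normDf_expCurve]
  refine Real.le_sqrt_of_sq_le ?_
  rw [div_pow, mul_pow, Real.sq_sqrt (by positivity), div_le_div_iff₀ (by positivity)
    (by positivity)]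
  have hbound : ∀ q : ℝ, (∀ l, weight g z l ≤ q) → ∑ l, weight g z l ≤ (n + 1) * q := by
    intro q hq
    calc ∑ l, weight g z l ≤ ∑ _l : Fin (n + 1), q := Finset.sum_le_sum fun l _ => hq l
      _ = (n + 1) * q := by simp
  -- One factor of the square is bounded through `i`, the other through `j`, to match the product of
  -- weights in `hterm`.
  have hSS : (∑ l, weight g z l) ^ 2 ≤ (n + 1) ^ 2 * (weight g z i * weight g z j) := by
    calc (∑ l, weight g z l) ^ 2 = (∑ l, weight g z l) * ∑ l, weight g z l := sq _
      _ ≤ ((n + 1) * weight g z i) * ((n + 1) * weight g z j) :=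
        mul_le_mul (hbound _ hi) (hbound _ hj) hS.le
          (mul_nonneg (by positivity) (weight_pos g z i).le)
      _ = _ := by ring
  have hnn : ∀ a b, 0 ≤ weight g z a * weight g z b * ‖logDer g z a - logDer g z b‖ ^ 2 :=
    fun a b => mul_nonneg (mul_nonneg (weight_pos g z a).le (weight_pos g z b).le) (sq_nonneg _)
  -- Only the (i, j) term of the double sum is kept. The 2 here and the 1/π of the metric account
  -- for √(2π).
  have hterm : weight g z i * weight g z j * ‖logDer g z i - logDer g z j‖ ^ 2 ≤
      2 * ((∑ i, weight g z i) * (∑ i, weight g z i * ‖logDer g z i‖ ^ 2)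
        - ‖∑ i, (weight g z i : ℂ) * logDer g z i‖ ^ 2) := by
    rw [← sum_sum_mul_norm_sub_sq]
    refine le_trans ?_ (Finset.single_le_sum
      (fun a _ => Finset.sum_nonneg fun b _ => hnn a b) (Finset.mem_univ i))
    exact Finset.single_le_sum (f := fun b =>
      weight g z i * weight g z b * ‖logDer g z i - logDer g z b‖ ^ 2)
      (fun b _ => hnn i b) (Finset.mem_univ j)
  generalize (∑ i, weight g z i) * (∑ i, weight g z i * ‖logDer g z i‖ ^ 2)
        - ‖∑ i, (weight g z i : ℂ) * logDer g z i‖ ^ 2 = Q at hterm ⊢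
  calc _ ≤ ‖logDer g z i - logDer g z j‖ ^ 2 * ((n + 1) ^ 2 * (weight g z i * weight g z j)) :=
        mul_le_mul_of_nonneg_left hSS (sq_nonneg _)
    _ = (n + 1) ^ 2 * (weight g z i * weight g z j * ‖logDer g z i - logDer g z j‖ ^ 2) := by ring
    _ ≤ (n + 1) ^ 2 * (2 * Q) := mul_le_mul_of_nonneg_left hterm (by positivity)
    _ = _ := by
      have := Real.pi_ne_zero
      field_simp

/-! ### Asymptotics of polynomials -/

/-- P(z)/z^k is the reflected polynomial at 1/z, and its value at 0 is the coefficient of degree k.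
-/
theorem tendsto_eval_div_pow (P : ℂ[X]) {k : ℕ} (hP : P.natDegree ≤ k) :
    Tendsto (fun z => P.eval z / z ^ k) (cobounded ℂ) (𝓝 (P.coeff k)) := by
  have h1 : Tendsto (fun z : ℂ => (reflect k P).eval z⁻¹) (cobounded ℂ) (𝓝 (P.coeff k)) := by
    have h := ((reflect k P).continuous.tendsto 0).comp (tendsto_inv₀_cobounded (α := ℂ))
    rwa [← coeff_zero_eq_eval_zero, coeff_reflect, revAt_le (Nat.zero_le k), Nat.sub_zero] at h
  refine h1.congr' ?_
  filter_upwards [eventually_ne_cobounded (0 : ℂ)] with z hz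
  have : Invertible z := invertibleOfNonzero hz
  have h := eval₂_reflect_mul_pow (RingHom.id ℂ) z k P hP
  rw [invOf_eq_inv] at h
  rw [eq_div_iff (pow_ne_zero k hz)]
  exact h

theorem eventually_forall_norm_eq {p : ℂ → Prop} (h : ∀ᶠ z in cobounded ℂ, p z) :
    ∀ᶠ r : ℝ in atTop, ∀ z : ℂ, ‖z‖ = r → p z := by
  rwa [← comap_norm_atTop, eventually_comap] at h

theorem eventually_norm_eval_le (P : ℂ[X]) {k : ℕ} (hP : P.natDegree ≤ k) :
    ∀ᶠ r : ℝ in atTop, ∀ z : ℂ, ‖z‖ = r → ‖P.eval z‖ ≤ (‖P.coeff k‖ + 1) * r ^ k := by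
  have h := (tendsto_eval_div_pow P hP).norm.eventually_le_const (lt_add_one ‖P.coeff k‖)
  filter_upwards [eventually_forall_norm_eq h, eventually_gt_atTop 0] with r hr hr0 z hz
  have := hr z hz
  rwa [norm_div, norm_pow, hz, div_le_iff₀ (by positivity)] at this

theorem eventually_le_norm_eval (P : ℂ[X]) {k : ℕ} (hP : P.natDegree ≤ k) (h0 : P.coeff k ≠ 0) :
    ∀ᶠ r : ℝ in atTop, ∀ z : ℂ, ‖z‖ = r → ‖P.coeff k‖ / 2 * r ^ k ≤ ‖P.eval z‖ := by
  have h := (tendsto_eval_div_pow P hP).norm.eventually_const_le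
    (half_lt_self (norm_pos_iff.2 h0))
  filter_upwards [eventually_forall_norm_eq h, eventually_gt_atTop 0] with r hr hr0 z hz
  have := hr z hz
  rwa [norm_div, norm_pow, hz, le_div_iff₀ (by positivity)] at this

theorem eventually_re_eval_pos (P : ℂ[X]) {k : ℕ} (hP : P.natDegree ≤ k) {w : ℂ} (hw : w ≠ 0)
    (h : 0 < (P.coeff k * w ^ k).re) : ∀ᶠ r : ℝ in atTop, 0 < (P.eval (r * w)).re := by
  have hlim : Tendsto (fun r : ℝ => (r : ℂ) * w) atTop (cobounded ℂ) := by
    rw [← tendsto_norm_atTop_iff_cobounded]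
    simp only [norm_mul, Complex.norm_real]
    exact tendsto_norm_atTop_atTop.atTop_mul_const (norm_pos_iff.2 hw)
  have ht := (((tendsto_eval_div_pow P hP).comp hlim).mul_const (w ^ k))
  have ht' := (Complex.continuous_re.tendsto _).comp ht
  filter_upwards [ht'.eventually_const_lt h, eventually_gt_atTop 0] with r hr hr0
  have e : P.eval (r * w) / (r * w) ^ k * w ^ k = (((r ^ k)⁻¹ : ℝ) : ℂ) * P.eval (r * w) := by
    have : (r : ℂ) ≠ 0 := by exact_mod_cast hr0.ne'
    push_cast
    rw [mul_pow]
    field_simp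
  simp only [Function.comp_apply, e, Complex.re_ofReal_mul] at hr
  exact pos_of_mul_pos_right hr (by positivity)

/-- If the coefficients of degree `k` of a family of polynomials take both zero and nonzero values,
every large circle contains a point where the largest real part is attained by two members of the
family with different coefficients. -/
theorem eventually_exists_two_maximal {ι : Type*} [Fintype ι] (G : ι → ℂ[X]) {k : ℕ} (hk : 0 < k)
    (hG : ∀ i, (G i).natDegree ≤ k) {i₀ i₁ : ι} (h₀ : (G i₀).coeff k = 0)
    (h₁ : (G i₁).coeff k ≠ 0) :
    ∀ᶠ r : ℝ in atTop, ∃ z : ℂ, ‖z‖ = r ∧ ∃ i j, (G i).coeff k ≠ (G j).coeff k ∧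
      (∀ l, ((G l).eval z).re ≤ ((G i).eval z).re) ∧
      (∀ l, ((G l).eval z).re ≤ ((G j).eval z).re) := by
  classical
  -- A coefficient `a` of maximal modulus is an extreme point: among all coefficients b, Re(b · conj
  -- a / |a|) reaches |a| only at b = a.
  obtain ⟨i₂, -, hmax⟩ := Finset.exists_max_image Finset.univ (fun i => ‖(G i).coeff k‖)
    ⟨i₀, Finset.mem_univ _⟩
  set a := (G i₂).coeff k with ha
  have ha0 : 0 < ‖a‖ := (norm_pos_iff.2 h₁).trans_le (hmax i₁ (Finset.mem_univ _))
  have haC : (‖a‖ : ℂ) ≠ 0 := by exact_mod_cast ha0.ne'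
  set A := Finset.univ.filter fun i => (G i).coeff k = a with hA
  set B := Finset.univ.filter fun i => (G i).coeff k ≠ a with hB
  have hAne : A.Nonempty := ⟨i₂, by simp [hA, ha]⟩
  have hi₀B : i₀ ∈ B := by
    simp only [hB, Finset.mem_filter_univ, h₀]
    exact (norm_pos_iff.1 ha0).symm
  have hBne : B.Nonempty := ⟨i₀, hi₀B⟩
  have hnorm : ‖(starRingEnd ℂ) a / ‖a‖‖ = 1 := by
    rw [norm_div, RCLike.norm_conj, Complex.norm_real, norm_norm, div_self ha0.ne']
  have hamul : a * ((starRingEnd ℂ) a / ‖a‖) = ‖a‖ := by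
    rw [mul_div_assoc', Complex.mul_conj, Complex.normSq_eq_norm_sq, div_eq_iff haC]
    push_cast; ring
  have hroot : ∀ c : ℂ, ‖c‖ = 1 → ∃ w : ℂ, ‖w‖ = 1 ∧ w ^ k = c := by
    intro c hc
    obtain ⟨w, hw⟩ := IsAlgClosed.exists_pow_nat_eq c hk
    refine ⟨w, ?_, hw⟩
    have : ‖w‖ ^ k = 1 := by rw [← norm_pow, hw, hc]
    exact (pow_eq_one_iff_of_nonneg (norm_nonneg w) hk.ne').1 this
  -- In the direction `w`, a·w^k = |a| and `i₂ ∈ A` beats all of `B`; in the direction `w'`, a·w'^k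
  -- = -|a| and `i₀ ∈ B` beats all of `A`.
  obtain ⟨w, hw, hwk⟩ := hroot _ hnorm
  obtain ⟨w', hw', hwk'⟩ := hroot (-((starRingEnd ℂ) a / ‖a‖)) (by rw [norm_neg, hnorm])
  have hw0 : w ≠ 0 := norm_ne_zero_iff.1 (by rw [hw]; exact one_ne_zero)
  have hw0' : w' ≠ 0 := norm_ne_zero_iff.1 (by rw [hw']; exact one_ne_zero)
  have hpos : ∀ j ∈ B, ∀ᶠ r : ℝ in atTop, 0 < ((G i₂ - G j).eval (r * w)).re := by
    intro j hj
    refine eventually_re_eval_pos _ ((natDegree_sub_le_of_le (hG i₂) (hG j)).trans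
      (max_self k).le) hw0 ?_
    rw [coeff_sub, ← ha, hwk, sub_mul, hamul, Complex.sub_re, Complex.ofReal_re, sub_pos]
    set b := (G j).coeff k with hb
    have hn : ‖b * ((starRingEnd ℂ) a / ‖a‖)‖ = ‖b‖ := by rw [norm_mul, hnorm, mul_one]
    have hba : ‖b‖ ≤ ‖a‖ := hmax j (Finset.mem_univ _)
    refine lt_of_le_of_ne ((Complex.re_le_norm _).trans (hn.le.trans hba)) fun he => ?_
    -- If the real part equals |a| ≥ |b|, it equals the modulus, so the product is real and b = a,
    -- contradicting membership in `B`.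
    have h1 : (b * ((starRingEnd ℂ) a / ‖a‖)).re = ‖b * ((starRingEnd ℂ) a / ‖a‖)‖ :=
      le_antisymm (Complex.re_le_norm _) (by rw [he, hn]; exact hba)
    have h2 : b * ((starRingEnd ℂ) a / ‖a‖) = ‖a‖ := by
      have him : (b * ((starRingEnd ℂ) a / ‖a‖)).im = 0 := by
        have hsq := Complex.normSq_apply (b * ((starRingEnd ℂ) a / ‖a‖))
        rw [Complex.normSq_eq_norm_sq, ← h1] at hsq
        exact mul_self_eq_zero.1 (by linarith)
      exact Complex.ext (by rw [he, Complex.ofReal_re]) (by rw [him, Complex.ofReal_im])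
    have h3 : b = a := mul_right_cancel₀
      (norm_ne_zero_iff.1 (by rw [hnorm]; exact one_ne_zero)) (h2.trans hamul.symm)
    exact (Finset.mem_filter.1 hj).2 h3
  have hneg : ∀ i ∈ A, ∀ᶠ r : ℝ in atTop, 0 < ((G i₀ - G i).eval (r * w')).re := by
    intro i hi
    refine eventually_re_eval_pos _ ((natDegree_sub_le_of_le (hG i₀) (hG i)).trans
      (max_self k).le) hw0' ?_
    rw [coeff_sub, h₀, (Finset.mem_filter.1 hi).2, hwk', zero_sub, neg_mul_neg, hamul,
      Complex.ofReal_re]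
    exact ha0
  filter_upwards [(Finset.eventually_all B).2 hpos, (Finset.eventually_all A).2 hneg,
    eventually_gt_atTop 0] with r hrB hrA hr0
  have hcont : ∀ (s : Finset ι) (hs : s.Nonempty),
      Continuous fun z => s.sup' hs fun i => ((G i).eval z).re := fun s hs =>
    Continuous.finset_sup'_apply hs fun i _ => Complex.continuous_re.comp (G i).continuous
  have hmem : ∀ u : ℂ, ‖u‖ = 1 → (r : ℂ) * u ∈ Metric.sphere (0 : ℂ) r := by
    intro u hu
    rw [mem_sphere_zero_iff_norm, norm_mul, hu, mul_one, Complex.norm_real,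
      Real.norm_of_nonneg hr0.le]
  -- The maxima over `A` and over `B` exchange order between the two directions, so they agree
  -- somewhere on the connected circle; their common value is the overall maximum.
  obtain ⟨z, hz, hzeq⟩ := (isPreconnected_sphere
      (by rw [Complex.rank_real_complex]; exact Cardinal.one_lt_two) (0 : ℂ)
      r).intermediate_value₂ (hmem w' hw') (hmem w hw) (hcont A hAne).continuousOn
      (hcont B hBne).continuousOn
      (by
        refine Finset.sup'_le _ _ fun i hi => ?_
        refine le_trans ?_ (Finset.le_sup' (fun i => ((G i).eval ((r : ℂ) * w')).re) hi₀B)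
        have := hrA i hi
        rw [eval_sub, Complex.sub_re, sub_pos] at this
        exact this.le)
      (by
        refine Finset.sup'_le _ _ fun j hj => ?_
        refine le_trans ?_ (Finset.le_sup' (fun i => ((G i).eval ((r : ℂ) * w)).re)
          (show i₂ ∈ A by simp [hA, ha]))
        have := hrB j hj
        rw [eval_sub, Complex.sub_re, sub_pos] at this
        exact this.le)
  obtain ⟨i, hi, hie⟩ := Finset.exists_mem_eq_sup' hAne fun i => ((G i).eval z).re
  obtain ⟨j, hj, hje⟩ := Finset.exists_mem_eq_sup' hBne fun i => ((G i).eval z).re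
  have hall : ∀ l, ((G l).eval z).re ≤ A.sup' hAne fun i => ((G i).eval z).re := by
    intro l
    by_cases hl : (G l).coeff k = a
    · exact Finset.le_sup' (fun i => ((G i).eval z).re) (by simp [hA, hl])
    · rw [hzeq]
      exact Finset.le_sup' (fun i => ((G i).eval z).re) (by simp [hB, hl])
  refine ⟨z, mem_sphere_zero_iff_norm.1 hz, i, j, ?_, fun l => ?_, fun l => ?_⟩
  · rw [(Finset.mem_filter.1 hi).2]
    exact (Finset.mem_filter.1 hj).2.symm
  · rw [← hie]; exact hall l
  · rw [← hje, ← hzeq]; exact hall l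

/-! ### Growth of the differential -/

theorem natDegree_exponents_le {n : ℕ} (g : Fin n → ℂ[X]) {d : ℕ} (h : ∀ i, (g i).natDegree ≤ d)
    (i : Fin (n + 1)) : (exponents g i).natDegree ≤ d := by
  cases i using Fin.cases with
  | zero => simp [exponents]
  | succ i => simpa [exponents] using h i

theorem natDegree_derivative_le_of_le {P : ℂ[X]} {m : ℕ} (h : P.natDegree ≤ m + 1) :
    (derivative P).natDegree ≤ m :=
  (natDegree_derivative_le P).trans (by omega)

theorem eventually_normDf_expCurve_le {n : ℕ} (g : Fin n → ℂ[X]) {m : ℕ}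
    (h : ∀ i, (g i).natDegree ≤ m + 1) :
    ∃ C : ℝ, 0 < C ∧ ∀ᶠ r : ℝ in atTop, ∀ z : ℂ, ‖z‖ = r →
      normDf (expCurve g) z ≤ C * r ^ m := by
  refine ⟨∑ i, (‖(derivative (exponents g i)).coeff m‖ + 1),
    Finset.sum_pos (fun i _ => by positivity) Finset.univ_nonempty, ?_⟩
  have hev := eventually_all.2 fun i => eventually_norm_eval_le (derivative (exponents g i))
    (natDegree_derivative_le_of_le (natDegree_exponents_le g h i))
  filter_upwards [hev] with r hr z hz
  refine (normDf_expCurve_le g z).trans ?_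
  rw [Finset.sum_mul]
  exact Finset.sum_le_sum fun i _ => hr i z hz

theorem weight_le_weight {n : ℕ} {g : Fin n → ℂ[X]} {z : ℂ} {i j : Fin (n + 1)}
    (h : ((exponents g i).eval z).re ≤ ((exponents g j).eval z).re) :
    weight g z i ≤ weight g z j := by
  unfold weight
  rw [Complex.norm_exp, Complex.norm_exp]
  gcongr

theorem eventually_exists_le_normDf_expCurve {n : ℕ} (g : Fin n → ℂ[X]) {m : ℕ}
    (h : ∀ i, (g i).natDegree ≤ m + 1) {i₁ : Fin n} (h₁ : (g i₁).coeff (m + 1) ≠ 0) :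
    ∃ c : ℝ, 0 < c ∧ ∀ᶠ r : ℝ in atTop, ∃ z : ℂ, ‖z‖ = r ∧
      c * r ^ m ≤ normDf (expCurve g) z := by
  have hdeg := natDegree_exponents_le g h
  have hcoeff : ∀ i j, (derivative (exponents g i - exponents g j)).coeff m =
      ((exponents g i).coeff (m + 1) - (exponents g j).coeff (m + 1)) * (m + 1) := fun i j => by
    rw [coeff_derivative, coeff_sub]
  have key : ∀ q : Fin (n + 1) × Fin (n + 1), ∃ c : ℝ, 0 < c ∧
      ((exponents g q.1).coeff (m + 1) ≠ (exponents g q.2).coeff (m + 1) →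
        ∀ᶠ r : ℝ in atTop, ∀ z : ℂ, ‖z‖ = r →
          c * r ^ m ≤ ‖logDer g z q.1 - logDer g z q.2‖) := by
    rintro ⟨i, j⟩
    by_cases hij : (exponents g i).coeff (m + 1) = (exponents g j).coeff (m + 1)
    -- The claim is vacuous for this pair, so any positive constant serves.
    · exact ⟨1, one_pos, fun hne => absurd hij hne⟩
    have hne : (derivative (exponents g i - exponents g j)).coeff m ≠ 0 := by
      rw [hcoeff]
      exact mul_ne_zero (sub_ne_zero.2 hij) (Nat.cast_add_one_ne_zero m)
    refine ⟨_, half_pos (norm_pos_iff.2 hne), fun _ => ?_⟩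
    have := eventually_le_norm_eval _ (natDegree_derivative_le_of_le
      ((natDegree_sub_le_of_le (hdeg i) (hdeg j)).trans (max_self _).le)) hne
    simpa only [logDer, derivative_sub, eval_sub] using this
  choose c hc hcr using key
  -- The maximal pair depends on r; the minimum over the finitely many pairs gives a constant that
  -- does not.
  obtain ⟨q₀, -, hq₀⟩ := Finset.exists_min_image Finset.univ c ⟨(0, 0), Finset.mem_univ _⟩
  have hev : ∀ᶠ r : ℝ in atTop, ∀ q : Fin (n + 1) × Fin (n + 1),
      (exponents g q.1).coeff (m + 1) ≠ (exponents g q.2).coeff (m + 1) →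
        ∀ z : ℂ, ‖z‖ = r → c q * r ^ m ≤ ‖logDer g z q.1 - logDer g z q.2‖ :=
    eventually_all.2 fun q => eventually_imp_distrib_left.2 (hcr q)
  have hmax := eventually_exists_two_maximal (exponents g) m.succ_pos hdeg (i₀ := 0)
    (i₁ := i₁.succ) (by simp [exponents]) (by simpa [exponents] using h₁)
  refine ⟨c q₀ / (√(2 * Real.pi) * (n + 1)), div_pos (hc q₀) (by positivity), ?_⟩
  filter_upwards [hev, hmax, eventually_ge_atTop 0] with r hr hrz hr0
  obtain ⟨z, hz, i, j, hij, hi, hj⟩ := hrz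
  refine ⟨z, hz, le_trans ?_ (le_normDf_expCurve g z i j (fun l => weight_le_weight (hi l))
    fun l => weight_le_weight (hj l))⟩
  rw [div_mul_eq_mul_div]
  refine div_le_div_of_nonneg_right ?_ (by positivity)
  exact (mul_le_mul_of_nonneg_right (hq₀ (i, j) (Finset.mem_univ _)) (by positivity)).trans
    (hr (i, j) hij z hz)

/-- The extended logarithm is continuous at 0 as well, so compactness of the circle applies even
where |df| vanishes. -/
theorem isGreatest_maxLogNormDf_expCurve {n : ℕ} (g : Fin n → ℂ[X]) {r : ℝ} (hr : 0 ≤ r) :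
    IsGreatest (logNormDf (expCurve g) '' Metric.sphere (0 : ℂ) r)
      (maxLogNormDf (expCurve g) r) := by
  have hcont : Continuous (logNormDf (expCurve g)) :=
    ENNReal.continuous_log.comp (ENNReal.continuous_ofReal.comp (continuous_normDf_expCurve g))
  have h := ((isCompact_sphere (0 : ℂ) r).image hcont).sSup_mem
    ((NormedSpace.sphere_nonempty.2 hr).image _)
  rw [sSup_image] at h
  exact ⟨h, fun _ ⟨z, hz, hx⟩ => hx ▸ le_iSup₂ (f := fun z _ => logNormDf (expCurve g) z) z hz⟩

theorem tendsto_log_mul_pow_div_log {c : ℝ} (hc : 0 < c) (m : ℕ) :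
    Tendsto (fun r : ℝ => ((Real.log (c * r ^ m) : ℝ) : EReal) / (Real.log r : EReal)) atTop
      (𝓝 (m : EReal)) := by
  have h : Tendsto (fun r : ℝ => Real.log c / Real.log r + m) atTop (𝓝 (0 + m)) :=
    (Real.tendsto_log_atTop.const_div_atTop _).add_const _
  rw [zero_add] at h
  have h' := (continuous_coe_real_ereal.tendsto (m : ℝ)).comp h
  have e : (((m : ℝ) : EReal)) = (m : EReal) := rfl
  rw [e] at h'
  refine h'.congr' ?_
  filter_upwards [eventually_gt_atTop 1] with r hr
  have hl : Real.log r ≠ 0 := (Real.log_pos hr).ne'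
  have hr0 : r ≠ 0 := by positivity
  rw [← EReal.coe_div, Function.comp_apply, Real.log_mul hc.ne' (pow_ne_zero m hr0), Real.log_pow,
    add_div, mul_div_cancel_right₀ _ hl]

theorem tendsto_maxLogNormDf_expCurve_div_log {n : ℕ} (g : Fin n → ℂ[X]) {m : ℕ}
    (h : ∀ i, (g i).natDegree ≤ m + 1) {i₁ : Fin n} (h₁ : (g i₁).coeff (m + 1) ≠ 0) :
    Tendsto (fun r : ℝ => maxLogNormDf (expCurve g) r / (Real.log r : EReal)) atTop
      (𝓝 (m : EReal)) := by
  obtain ⟨C, hC, hup⟩ := eventually_normDf_expCurve_le g h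
  obtain ⟨c, hc, hlow⟩ := eventually_exists_le_normDf_expCurve g h h₁
  refine tendsto_of_tendsto_of_tendsto_of_le_of_le' (tendsto_log_mul_pow_div_log hc m)
    (tendsto_log_mul_pow_div_log hC m) ?_ ?_
  -- Taking r > 1 makes log r positive, so that division by it preserves order.
  · filter_upwards [hlow, eventually_gt_atTop 1] with r hr hr1
    obtain ⟨z, hz, hle⟩ := hr
    refine EReal.div_le_div_right_of_nonneg (by exact_mod_cast (Real.log_pos hr1).le) ?_
    rw [← ENNReal.log_ofReal_of_pos (by positivity)]
    refine le_trans ?_ (le_iSup₂ (f := fun z _ => logNormDf (expCurve g) z) z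
      (mem_sphere_zero_iff_norm.2 hz))
    exact ENNReal.log_monotone (ENNReal.ofReal_le_ofReal hle)
  · filter_upwards [hup, eventually_gt_atTop 1] with r hr hr1
    refine EReal.div_le_div_right_of_nonneg (by exact_mod_cast (Real.log_pos hr1).le) ?_
    rw [← ENNReal.log_ofReal_of_pos (by positivity)]
    refine iSup₂_le fun z hz => ENNReal.log_monotone (ENNReal.ofReal_le_ofReal ?_)
    exact hr z (mem_sphere_zero_iff_norm.1 hz)

end TorusCurve

theorem theorem2 {n : ℕ} (g : Fin n → Polynomial ℂ) (m : ℕ)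
    (hm : m + 1 = Finset.univ.sup fun i => (g i).natDegree) :
    (∀ r : ℝ, 0 < r →
      IsGreatest (TorusCurve.logNormDf (TorusCurve.expCurve g) '' Metric.sphere (0 : ℂ) r)
        (TorusCurve.maxLogNormDf (TorusCurve.expCurve g) r)) ∧
    Filter.limsup
      (fun r : ℝ => TorusCurve.maxLogNormDf (TorusCurve.expCurve g) r / (Real.log r : EReal))
      Filter.atTop = (m : EReal) := by
  have hle : ∀ i, (g i).natDegree ≤ m + 1 := fun i => by
    rw [hm]
    exact Finset.le_sup (f := fun i => (g i).natDegree) (Finset.mem_univ i)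
  -- The supremum over an empty family is 0, so `hm` itself forces n ≥ 1.
  have hn : (Finset.univ : Finset (Fin n)).Nonempty := by
    rw [Finset.nonempty_iff_ne_empty]
    intro he
    rw [he, Finset.sup_empty] at hm
    exact Nat.succ_ne_zero m hm
  obtain ⟨i₁, -, hi₁⟩ := Finset.exists_mem_eq_sup _ hn fun i => (g i).natDegree
  have hdeg : (g i₁).natDegree = m + 1 := (hm.trans hi₁).symm
  have hcoeff : (g i₁).coeff (m + 1) ≠ 0 := by
    rw [← hdeg, Polynomial.coeff_natDegree, Polynomial.leadingCoeff_ne_zero]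
    rintro h0
    rw [h0, Polynomial.natDegree_zero] at hdeg
    exact Nat.succ_ne_zero m hdeg.symm
  exact ⟨fun r hr => TorusCurve.isGreatest_maxLogNormDf_expCurve g hr.le,
    (TorusCurve.tendsto_maxLogNormDf_expCurve_div_log g hle hcoeff).limsup_eq⟩
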